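/- Let $d,k\ge 0$ and $N\ge 1$ be integers, let $X\in\mathbb{R}^{d\times k}$ and $\sigma\ge 0$, and set $G=X^TX$. Let $Y_1,\dots,Y_N$ be i.i.d. observations, each distributed as $QX+\sigma E$, where $Q$ is a random orthogonal $d\times d$ matrix (with an arbitrary law on $O(d)$), and $E\in\mathbb{R}^{d\times k}$ is independent of $Q$ and has i.i.d. standard Gaussian entries. Let $$\hat G_N=\frac1N\sum_{i=1}^N Y_i^TY_i-d\sigma^2 I_k$$ be the debiased Gram estimator. Write $\|\cdot\|$ for the Frobenius norm and $\|\cdot\|_{\mathrm{op}}$ for the operator norm (largest singular value). Let $\lambda_1\ge\dots\ge\lambda_k$ be the eigenvalues of $\hat G_N$ with corresponding orthonormal eigenvectors $v_1,\dots,v_k$, and put $\alpha_i=\sqrt{\max(\lambda_i,0)}$. Then, for every choice of such eigenvectors, $$\sum_{i=1}^{\min(d,k)}\alpha_i^2\,v_iv_i^T\ \in\ \underset{H\succeq 0:\ \mathrm{rank}(H)\le d}{\mathrm{argmin}}\ \|\hat G_N-H\|_{\mathrm{op}},$$ and for every $\delta\in(0,1)$, with probability at least $1-\delta$, every element $\tilde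 G_N$ of this argmin (in particular the above sum) satisfies $$\|\tilde G_N-G\|\le 8\sqrt{2d}\left[\sqrt{\frac{2\|X\|_{\mathrm{op}}^2\sigma^2+d\sigma^4}{N}\,k\log\frac{10}{\delta}}+\frac{\sigma^2}{N}\,k\log\frac{10}{\delta}\right].$$ -/

import Mathlib

open MeasureTheory ProbabilityTheory

namespace Procrustes

/-- Matrices carry the product (Borel) σ-algebra of their entries. -/
instance instMeasurableSpaceMatrix {m n : ℕ} : MeasurableSpace (Matrix (Fin m) (Fin n) ℝ) :=
  inferInstanceAs (MeasurableSpace (Fin m → Fin n → ℝ))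

/-- Frobenius norm of a real matrix. -/
noncomputable def frobNorm {m n : ℕ} (A : Matrix (Fin m) (Fin n) ℝ) : ℝ :=
  letI := Matrix.frobeniusNormedAddCommGroup (m := Fin m) (n := Fin n) (α := ℝ)
  ‖A‖

/-- Operator norm of a real matrix with respect to the Euclidean norms (its largest singular
value). -/
noncomputable def opNorm {m n : ℕ} (A : Matrix (Fin m) (Fin n) ℝ) : ℝ :=
  letI := Matrix.instL2OpNormedAddCommGroup (𝕜 := ℝ) (m := Fin m) (n := Fin n)
  ‖A‖

/-- Law of a random `d × k` matrix whose entries are independent standard Gaussians. -/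
noncomputable def stdGaussianMatrix (d k : ℕ) : Measure (Matrix (Fin d) (Fin k) ℝ) :=
  Measure.pi (fun _ : Fin d => Measure.pi (fun _ : Fin k => gaussianReal 0 1))

/-- Law of one observation `Y = Q X + σ E`, where `Q` is a random orthogonal matrix with law `ν`
and `E`, independent of `Q`, has independent standard Gaussian entries. -/
noncomputable def observationLaw {d k : ℕ} (ν : Measure (Matrix.orthogonalGroup (Fin d) ℝ))
    (X : Matrix (Fin d) (Fin k) ℝ) (σ : ℝ) : Measure (Matrix (Fin d) (Fin k) ℝ) :=
  (ν.prod (stdGaussianMatrix d k)).map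
    (fun p => (p.1 : Matrix (Fin d) (Fin d) ℝ) * X + σ • p.2)

/-- The debiased Gram estimator `(1/N) ∑ Yᵢᵀ Yᵢ - d σ² I`. -/
noncomputable def gramEstimator {d k N : ℕ} (σ : ℝ) (Y : Fin N → Matrix (Fin d) (Fin k) ℝ) :
    Matrix (Fin k) (Fin k) ℝ :=
  (1 / (N : ℝ)) • (∑ i, (Y i).transpose * Y i)
    - ((d : ℝ) * σ ^ 2) • (1 : Matrix (Fin k) (Fin k) ℝ)

/-- The operator-norm projections of `A` to the set of positive semidefinite matrices of rank at
most `d`, i.e. the minimizers of `‖A - H‖` over that set. -/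
def psdRankArgmin {k : ℕ} (d : ℕ) (A : Matrix (Fin k) (Fin k) ℝ) :
    Set (Matrix (Fin k) (Fin k) ℝ) :=
  {H | H.PosSemidef ∧ H.rank ≤ d ∧
    ∀ K : Matrix (Fin k) (Fin k) ℝ, K.PosSemidef → K.rank ≤ d →
      opNorm (A - H) ≤ opNorm (A - K)}

/-- The matrices `∑ αᵢ² vᵢ vᵢᵀ`, summed over the first `d` indices, where `v₁, …, v_k` is an
orthonormal basis of eigenvectors of `A` with eigenvalues `lam₁ ≥ … ≥ lam_k` and
`αᵢ = √(max(lamᵢ, 0))`. -/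
def spectralTruncations {k : ℕ} (d : ℕ) (A : Matrix (Fin k) (Fin k) ℝ) :
    Set (Matrix (Fin k) (Fin k) ℝ) :=
  {H | ∃ (v : OrthonormalBasis (Fin k) ℝ (EuclideanSpace ℝ (Fin k))) (lam : Fin k → ℝ),
    Antitone lam ∧
    (∀ i, A.mulVec (v i).ofLp = lam i • (v i).ofLp) ∧
    H = ∑ i : Fin k with i.val < d,
      (Real.sqrt (max (lam i) 0)) ^ 2 • Matrix.vecMulVec (v i).ofLp (v i).ofLp}

instance instIsProbabilityMeasureStdGaussianMatrix (d k : ℕ) :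
    IsProbabilityMeasure (stdGaussianMatrix d k) :=
  inferInstanceAs (IsProbabilityMeasure
    (Measure.pi (fun _ : Fin d => Measure.pi (fun _ : Fin k => gaussianReal 0 1))))

/-- The map defining the observation law is measurable, so that law is a genuine push-forward. -/
theorem measurable_observation {d k : ℕ} (X : Matrix (Fin d) (Fin k) ℝ) (σ : ℝ) :
    Measurable (fun p : Matrix.orthogonalGroup (Fin d) ℝ × Matrix (Fin d) (Fin k) ℝ =>
      (p.1 : Matrix (Fin d) (Fin d) ℝ) * X + σ • p.2) := by
  refine measurable_pi_lambda _ fun i => measurable_pi_lambda _ fun j => ?_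
  simp only [Matrix.add_apply, Matrix.mul_apply, Matrix.smul_apply, smul_eq_mul]
  refine Measurable.add (Finset.measurable_sum _ fun l _ => Measurable.mul_const ?_ _)
    (Measurable.const_mul ?_ _)
  · exact (measurable_pi_apply l).comp
      ((measurable_pi_apply i).comp (measurable_subtype_coe.comp measurable_fst))
  · exact (measurable_pi_apply j).comp ((measurable_pi_apply i).comp measurable_snd)

instance instIsProbabilityMeasureObservationLaw {d k : ℕ}
    (ν : Measure (Matrix.orthogonalGroup (Fin d) ℝ)) [IsProbabilityMeasure ν]
    (X : Matrix (Fin d) (Fin k) ℝ) (σ : ℝ) : IsProbabilityMeasure (observationLaw ν X σ) :=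
  Measure.isProbabilityMeasure_map (measurable_observation X σ).aemeasurable

end Procrustes

/-!
The error bound has a deterministic and a probabilistic half.

*Deterministic half.* Let `A` be symmetric with eigenbasis `v` and eigenvalues `lam`. If `K` is
positive semidefinite of rank at most `d`, then `‖A - K‖` is at least `-lam i` for every `i` (test on
`v i`) and at least `lam i` for every `i ≥ d` (test on a kernel vector of `K` in the span of
`v 0, …, v i`). The spectral truncation attains the largest of these bounds, so it is a minimizer:
`spectralTruncations_subset_psdRankArgmin`. If `H` is any minimizer and `G` is admissible, then
`‖H - G‖ ≤ 2 ‖A - G‖` in operator norm; as `H - G` has rank at most `2 d`, passing to the Frobenius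
norm costs a factor `√(2 d)`: `frobNorm_sub_le_of_mem_psdRankArgmin`.

*Probabilistic half.* It remains to bound the operator norm of `Ĝ - G` by four times the bracket. For
a unit vector `u`, conditionally on the rotation, `‖Y u‖²` is a scaled noncentral chi-square variable
which depends on the rotation only through `‖Q X u‖ = ‖X u‖`, so its moment generating function is
explicit (`integral_exp_observationLaw`). After centring, its logarithm at `t` is at most
`t² V / (1 - 2 |t| σ²)` with `V = 2 ‖X‖² σ² + d σ⁴`, and the Chernoff bound gives
`|uᵀ (Ĝ - G) u| < 2 (√(V s / N) + σ² s / N)` outside an event of probability `2 exp (-s)`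
(`measure_quadratic_form_ge_le`). A quadratic form does not distinguish `u` from `-u`, so a union
bound over a `1 / 4`-net of the sphere up to sign suffices, and it costs another factor `2`
(`opNorm_le_of_net`). Such a net has at most `9 ^ k / 2` elements (`exists_net_up_to_sign`), which
matches `s = k log (10 / δ)`. The Chernoff bound needs `V > 0`; if `d = 0` or `σ = 0`, the error
vanishes almost surely.
-/

namespace Procrustes

/-! ### Nets of the sphere -/

/-- A `1`-separated subset of the ball of radius `4` has at most `9 ^ n` elements: the balls of
radius `1 / 2` around its points are disjoint and lie in the ball of radius `9 / 2`. -/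
theorem card_le_of_separated {E : Type*} [NormedAddCommGroup E] [NormedSpace ℝ E]
    [FiniteDimensional ℝ E] (s : Finset E) (hs : ∀ c ∈ s, ‖c‖ ≤ 4)
    (h : ∀ c ∈ s, ∀ e ∈ s, c ≠ e → 1 ≤ ‖c - e‖) :
    s.card ≤ 9 ^ Module.finrank ℝ E := by
  borelize E
  let μ : Measure E := Measure.addHaar
  have D : Set.Pairwise (s : Set E)
      (Function.onFun Disjoint fun c => Metric.ball (c : E) (1 / 2)) := by
    intro c hc e he hce
    apply Metric.ball_disjoint_ball
    rw [dist_eq_norm]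
    linarith [h c hc e he hce]
  have hsub : (⋃ c ∈ s, Metric.ball (c : E) (1 / 2)) ⊆ Metric.ball (0 : E) (9 / 2) := by
    refine Set.iUnion₂_subset fun x hx => Metric.ball_subset_ball' ?_
    rw [dist_zero_right]
    linarith [hs x hx]
  have hvol : (s.card : ENNReal) * ENNReal.ofReal ((1 / 2) ^ Module.finrank ℝ E) *
      μ (Metric.ball 0 1) ≤
      ENNReal.ofReal ((9 / 2) ^ Module.finrank ℝ E) * μ (Metric.ball 0 1) := by
    have := measure_mono (μ := μ) hsub
    rw [measure_biUnion_finset D fun c _ => measurableSet_ball] at this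
    simpa only [μ.addHaar_ball_of_pos _ (by norm_num : (0 : ℝ) < 1 / 2),
      μ.addHaar_ball_of_pos _ (by norm_num : (0 : ℝ) < 9 / 2), Finset.sum_const, nsmul_eq_mul,
      mul_assoc] using this
  have hcard := (ENNReal.mul_le_mul_iff_left (Metric.measure_ball_pos _ _ zero_lt_one).ne'
    measure_ball_lt_top.ne).1 hvol
  have : (s.card : ℝ) ≤ (9 : ℝ) ^ Module.finrank ℝ E := by
    have := ENNReal.toReal_le_of_le_ofReal (by positivity) hcard
    simpa [div_eq_mul_inv, mul_pow] using this
  exact mod_cast this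

/-- The unit sphere has a `1 / 4`-net up to sign with at most `9 ^ n / 2` elements. -/
theorem exists_net_up_to_sign (E : Type*) [NormedAddCommGroup E] [NormedSpace ℝ E]
    [FiniteDimensional ℝ E] :
    ∃ t : Finset E, 2 * t.card ≤ 9 ^ Module.finrank ℝ E ∧ (∀ y ∈ t, ‖y‖ = 1) ∧
      ∀ x : E, ‖x‖ = 1 → ∃ y ∈ t, ‖x - y‖ ≤ 1 / 4 ∨ ‖x + y‖ ≤ 1 / 4 := by
  classical
  let good : Finset E → Prop := fun t => (∀ y ∈ t, ‖y‖ = 1) ∧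
    ∀ y ∈ t, ∀ z ∈ t, y ≠ z → 1 / 4 ≤ ‖y - z‖ ∧ 1 / 4 ≤ ‖y + z‖
  -- the volume bound applies to `t ∪ -t`, which has twice as many elements as `t`
  have hgood : ∀ t, good t → 2 * t.card ≤ 9 ^ Module.finrank ℝ E := by
    rintro t ⟨h1, h2⟩
    have hne : ∀ y ∈ t, ∀ z ∈ t, 1 / 4 ≤ ‖y + z‖ := by
      intro y hy z hz
      by_cases hyz : y = z
      · subst hyz
        rw [← two_smul ℝ y, norm_smul, h1 y hy]
        norm_num
      · exact (h2 y hy z hz hyz).2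
    have hdisj : Disjoint t (t.image fun y => -y) := by
      rw [Finset.disjoint_left]
      intro y hy hy'
      obtain ⟨z, hz, rfl⟩ := Finset.mem_image.1 hy'
      have := hne _ hy z hz
      norm_num at this
    have hsep : ∀ y ∈ t ∪ t.image (fun y => -y), ∀ z ∈ t ∪ t.image (fun y => -y), y ≠ z →
        1 / 4 ≤ ‖y - z‖ := by
      intro y hy z hz hyz
      rcases Finset.mem_union.1 hy with hy | hy <;> rcases Finset.mem_union.1 hz with hz | hz
      · exact (h2 y hy z hz hyz).1
      · obtain ⟨w, hw, rfl⟩ := Finset.mem_image.1 hz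
        simpa using hne y hy w hw
      · obtain ⟨w, hw, rfl⟩ := Finset.mem_image.1 hy
        rw [← norm_neg]
        simpa [add_comm] using hne w hw z hz
      · obtain ⟨w, hw, rfl⟩ := Finset.mem_image.1 hz
        obtain ⟨w', hw', rfl⟩ := Finset.mem_image.1 hy
        have := (h2 w hw w' hw' (by rintro rfl; exact hyz rfl)).1
        convert this using 2
        abel
    have hnorm : ∀ y ∈ t ∪ t.image (fun y => -y), ‖y‖ = 1 := by
      intro y hy
      rcases Finset.mem_union.1 hy with hy | hy
      · exact h1 y hy
      · obtain ⟨w, hw, rfl⟩ := Finset.mem_image.1 hy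
        rw [norm_neg]
        exact h1 w hw
    have hinj : Function.Injective fun y : E => (4 : ℝ) • y :=
      smul_right_injective E (by norm_num)
    have := card_le_of_separated ((t ∪ t.image fun y => -y).image fun y => (4 : ℝ) • y)
      (by
        intro c hc
        obtain ⟨y, hy, rfl⟩ := Finset.mem_image.1 hc
        rw [norm_smul, hnorm y hy]
        norm_num)
      (by
        intro c hc e he hce
        obtain ⟨y, hy, rfl⟩ := Finset.mem_image.1 hc
        obtain ⟨z, hz, rfl⟩ := Finset.mem_image.1 he
        rw [← smul_sub, norm_smul]
        have := hsep y hy z hz (by rintro rfl; exact hce rfl)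
        norm_num
        linarith)
    rw [Finset.card_image_of_injective _ hinj, Finset.card_union_of_disjoint hdisj,
      Finset.card_image_of_injective _ neg_injective] at this
    linarith
  by_contra! hcon
  -- without a net, good sets could be enlarged indefinitely
  have hall : ∀ n : ℕ, ∃ t, good t ∧ t.card = n := by
    intro n
    induction n with
    | zero => exact ⟨∅, ⟨by simp, by simp⟩, rfl⟩
    | succ n ih =>
      obtain ⟨t, ht, rfl⟩ := ih
      obtain ⟨x, hx, hxt⟩ := hcon t (hgood t ht) ht.1
      refine ⟨insert x t, ⟨?_, ?_⟩, ?_⟩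
      · intro y hy
        rcases Finset.mem_insert.1 hy with rfl | hy
        exacts [hx, ht.1 y hy]
      · intro y hy z hz hyz
        rcases Finset.mem_insert.1 hy with hyx | hyt <;>
          rcases Finset.mem_insert.1 hz with hzx | hzt
        · exact absurd (hyx.trans hzx.symm) hyz
        · rw [hyx]
          exact ⟨(hxt z hzt).1.le, (hxt z hzt).2.le⟩
        · rw [hzx, norm_sub_rev, add_comm]
          exact ⟨(hxt y hyt).1.le, (hxt y hyt).2.le⟩
        · exact ht.2 y hyt z hzt hyz
      · refine Finset.card_insert_of_notMem fun hmem => ?_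
        have := (hxt x hmem).1
        norm_num at this
  obtain ⟨t, ht, hc⟩ := hall (9 ^ Module.finrank ℝ E + 1)
  have := hgood t ht
  omega

/-! ### Operator and Frobenius norms of symmetric matrices -/

theorem opNorm_eq_norm_toEuclideanCLM {k : ℕ} (M : Matrix (Fin k) (Fin k) ℝ) :
    opNorm M = ‖Matrix.toEuclideanCLM (n := Fin k) (𝕜 := ℝ) M‖ := rfl

theorem norm_toLp_mulVec_le {m n : ℕ} (M : Matrix (Fin m) (Fin n) ℝ)
    (x : EuclideanSpace ℝ (Fin n)) :
    ‖WithLp.toLp 2 (M.mulVec x.ofLp)‖ ≤ opNorm M * ‖x‖ :=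
  Matrix.l2_opNorm_mulVec M x

theorem opNorm_nonneg {m n : ℕ} (M : Matrix (Fin m) (Fin n) ℝ) : 0 ≤ opNorm M :=
  letI := Matrix.instL2OpNormedAddCommGroup (𝕜 := ℝ) (m := Fin m) (n := Fin n)
  norm_nonneg M

theorem opNorm_sub_le {k : ℕ} (A B C : Matrix (Fin k) (Fin k) ℝ) :
    opNorm (A - C) ≤ opNorm (A - B) + opNorm (B - C) :=
  letI := Matrix.instL2OpNormedAddCommGroup (𝕜 := ℝ) (m := Fin k) (n := Fin k)
  norm_sub_le_norm_sub_add_norm_sub A B C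

theorem opNorm_sub_comm {k : ℕ} (A B : Matrix (Fin k) (Fin k) ℝ) :
    opNorm (A - B) = opNorm (B - A) :=
  letI := Matrix.instL2OpNormedAddCommGroup (𝕜 := ℝ) (m := Fin k) (n := Fin k)
  norm_sub_rev A B

theorem abs_dotProduct_mulVec_le {k : ℕ} (M : Matrix (Fin k) (Fin k) ℝ)
    (x y : EuclideanSpace ℝ (Fin k)) :
    |x.ofLp ⬝ᵥ M.mulVec y.ofLp| ≤ opNorm M * ‖x‖ * ‖y‖ := by
  rw [← Matrix.inner_toEuclideanCLM]
  refine (abs_real_inner_le_norm _ _).trans ?_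
  rw [opNorm_eq_norm_toEuclideanCLM]
  have := (Matrix.toEuclideanCLM (n := Fin k) (𝕜 := ℝ) M).le_opNorm y
  nlinarith [norm_nonneg x]

/-- The operator norm of a symmetric matrix is governed by its quadratic form. -/
theorem opNorm_le_of_abs_dotProduct_le {k : ℕ} {M : Matrix (Fin k) (Fin k) ℝ}
    (hM : M.IsHermitian) {c : ℝ} (hc : 0 ≤ c)
    (h : ∀ x : EuclideanSpace ℝ (Fin k), ‖x‖ = 1 → |x.ofLp ⬝ᵥ M.mulVec x.ofLp| ≤ c) :
    opNorm M ≤ c := by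
  have hsymm : (Matrix.toEuclideanCLM (n := Fin k) (𝕜 := ℝ) M :
      EuclideanSpace ℝ (Fin k) →ₗ[ℝ] EuclideanSpace ℝ (Fin k)).IsSymmetric := by
    rw [Matrix.coe_toEuclideanCLM_eq_toEuclideanLin]
    exact Matrix.isSymmetric_toEuclideanLin_iff.2 hM
  rw [opNorm_eq_norm_toEuclideanCLM, ContinuousLinearMap.norm_eq_iSup_rayleighQuotient _ hsymm]
  refine ciSup_le fun x => ?_
  by_cases hx : x = 0
  · simpa [hx] using hc
  have hx' : ‖x‖ ≠ 0 := norm_ne_zero_iff.2 hx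
  have h1 : ‖(‖x‖⁻¹ : ℝ) • x‖ = 1 := by
    rw [norm_smul, norm_inv, norm_norm, inv_mul_cancel₀ hx']
  rw [← ContinuousLinearMap.rayleigh_smul _ x (inv_ne_zero hx'),
    ContinuousLinearMap.rayleighQuotient, h1, one_pow, div_one,
    ContinuousLinearMap.reApplyInnerSelf_apply, real_inner_comm, Matrix.inner_toEuclideanCLM]
  exact h _ h1

/-- On a symmetric matrix, a `1 / 4`-net of the unit sphere determines the operator norm up to a
factor `2`. -/
theorem opNorm_le_of_net {k : ℕ} {M : Matrix (Fin k) (Fin k) ℝ} (hM : M.IsHermitian)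
    {t : Finset (EuclideanSpace ℝ (Fin k))} (ht : ∀ y ∈ t, ‖y‖ = 1)
    (hnet : ∀ x : EuclideanSpace ℝ (Fin k), ‖x‖ = 1 →
      ∃ y ∈ t, ‖x - y‖ ≤ 1 / 4 ∨ ‖x + y‖ ≤ 1 / 4)
    {c : ℝ} (hc : 0 ≤ c) (h : ∀ y ∈ t, |y.ofLp ⬝ᵥ M.mulVec y.ofLp| ≤ c) :
    opNorm M ≤ 2 * c := by
  have key : ∀ x y : EuclideanSpace ℝ (Fin k), ‖x‖ = 1 → ‖y‖ = 1 → ‖x - y‖ ≤ 1 / 4 →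
      |y.ofLp ⬝ᵥ M.mulVec y.ofLp| ≤ c →
      |x.ofLp ⬝ᵥ M.mulVec x.ofLp| ≤ c + opNorm M / 2 := by
    intro x y hx hy hxy hyc
    have e : x.ofLp ⬝ᵥ M.mulVec x.ofLp = y.ofLp ⬝ᵥ M.mulVec y.ofLp +
        (x.ofLp ⬝ᵥ M.mulVec (x - y).ofLp + (x - y).ofLp ⬝ᵥ M.mulVec y.ofLp) := by
      simp only [WithLp.ofLp_sub, Matrix.mulVec_sub, dotProduct_sub, sub_dotProduct]
      ring
    have h1 := abs_dotProduct_mulVec_le M x (x - y)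
    have h2 := abs_dotProduct_mulVec_le M (x - y) y
    rw [hx, mul_one] at h1
    rw [hy, mul_one] at h2
    have h3 : opNorm M * ‖x - y‖ ≤ opNorm M * (1 / 4) :=
      mul_le_mul_of_nonneg_left hxy (opNorm_nonneg M)
    rw [e]
    refine (abs_add_le _ _).trans ?_
    have := abs_add_le (x.ofLp ⬝ᵥ M.mulVec (x - y).ofLp) ((x - y).ofLp ⬝ᵥ M.mulVec y.ofLp)
    linarith
  have := opNorm_le_of_abs_dotProduct_le hM (c := c + opNorm M / 2)
    (by have := opNorm_nonneg M; positivity) (fun x hx => by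
      obtain ⟨y, hy, hxy | hxy⟩ := hnet x hx
      · exact key x y hx (ht y hy) hxy (h y hy)
      · refine key x (-y) hx (by rw [norm_neg, ht y hy]) (by rwa [sub_neg_eq_add]) ?_
        simpa [Matrix.mulVec_neg] using h y hy)
  linarith

theorem frobNorm_sq {m n : ℕ} (M : Matrix (Fin m) (Fin n) ℝ) :
    frobNorm M ^ 2 = (M.transpose * M).trace := by
  have h0 : 0 ≤ ∑ i, ∑ j, ‖M i j‖ ^ (2 : ℝ) := by positivity
  rw [frobNorm, Matrix.frobenius_norm_def, ← Real.sqrt_eq_rpow, Real.sq_sqrt h0,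
    Finset.sum_comm]
  simp [Matrix.trace, Matrix.mul_apply, sq]

theorem abs_eigenvalues_le_opNorm {k : ℕ} {M : Matrix (Fin k) (Fin k) ℝ} (hM : M.IsHermitian)
    (i : Fin k) : |hM.eigenvalues i| ≤ opNorm M := by
  have h := norm_toLp_mulVec_le M (hM.eigenvectorBasis i)
  have e := hM.mulVec_eigenvectorBasis i
  rw [e] at h
  have h1 : ‖hM.eigenvectorBasis i‖ = 1 := hM.eigenvectorBasis.norm_eq_one i
  rwa [h1, WithLp.toLp_smul, norm_smul, WithLp.toLp_ofLp, h1, mul_one, mul_one] at h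

/-- The squared Frobenius norm is the sum of the squared eigenvalues, of which `M.rank` are nonzero
and each is at most the squared operator norm. -/
theorem frobNorm_le_sqrt_rank_mul_opNorm {k : ℕ} {M : Matrix (Fin k) (Fin k) ℝ}
    (hM : M.IsHermitian) : frobNorm M ≤ Real.sqrt M.rank * opNorm M := by
  have htr : (M.transpose * M).trace = ∑ i, hM.eigenvalues i ^ 2 := by
    have hT : M.transpose = M := hM
    rw [hT]
    have : (M * M).trace = ((Unitary.conjStarAlgAut ℝ _ hM.eigenvectorUnitary)
        (Matrix.diagonal hM.eigenvalues * Matrix.diagonal hM.eigenvalues)).trace := by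
      rw [map_mul]
      congr 2 <;> exact hM.spectral_theorem
    rw [this, Unitary.conjStarAlgAut_apply, Matrix.trace_mul_cycle]
    simp [Matrix.trace, sq]
  have hsq : frobNorm M ^ 2 ≤ M.rank * opNorm M ^ 2 := by
    rw [frobNorm_sq, htr, hM.rank_eq_card_non_zero_eigs, Fintype.card_subtype, ← nsmul_eq_mul,
      ← Finset.sum_const, Finset.sum_filter]
    refine Finset.sum_le_sum fun i _ => ?_
    split_ifs with h
    · exact sq_le_sq' (neg_le_of_abs_le (abs_eigenvalues_le_opNorm hM i))
        (le_of_abs_le (abs_eigenvalues_le_opNorm hM i))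
    · simp [not_not.1 h]
  have h0 : 0 ≤ Real.sqrt M.rank * opNorm M := by have := opNorm_nonneg M; positivity
  refine le_of_sq_le_sq ?_ h0
  rw [mul_pow, Real.sq_sqrt (by positivity)]
  exact hsq

theorem rank_sub_le {k : ℕ} (A B : Matrix (Fin k) (Fin k) ℝ) :
    (A - B).rank ≤ A.rank + B.rank := by
  have : LinearMap.range (A - B).mulVecLin ≤
      LinearMap.range A.mulVecLin ⊔ LinearMap.range B.mulVecLin := by
    rintro _ ⟨x, rfl⟩
    rw [Matrix.mulVecLin_apply, Matrix.sub_mulVec]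
    exact Submodule.sub_mem_sup ⟨x, rfl⟩ ⟨x, rfl⟩
  exact (Submodule.finrank_mono this).trans (Submodule.finrank_add_le_finrank_add_finrank _ _)

/-- A best positive semidefinite approximation of rank at most `d` of `A` is, in Frobenius norm,
close to every `G` of that kind which is close to `A` in operator norm. -/
theorem frobNorm_sub_le_of_mem_psdRankArgmin {k d : ℕ} {A G H : Matrix (Fin k) (Fin k) ℝ}
    (hH : H ∈ psdRankArgmin d A) (hG : G.PosSemidef) (hGd : G.rank ≤ d) :
    frobNorm (H - G) ≤ Real.sqrt (2 * d) * (2 * opNorm (A - G)) := by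
  obtain ⟨hH1, hH2, hH3⟩ := hH
  refine (frobNorm_le_sqrt_rank_mul_opNorm (hH1.isHermitian.sub hG.isHermitian)).trans ?_
  have hr : ((H - G).rank : ℝ) ≤ 2 * d := by
    have := rank_sub_le H G
    exact mod_cast (by omega : (H - G).rank ≤ 2 * d)
  have ho : opNorm (H - G) ≤ 2 * opNorm (A - G) := by
    have h1 := opNorm_sub_le H A G
    have h2 := hH3 G hG hGd
    rw [opNorm_sub_comm H A] at h1
    linarith
  exact mul_le_mul (Real.sqrt_le_sqrt hr) ho (opNorm_nonneg _) (Real.sqrt_nonneg _)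

/-! ### Spectral truncations are best approximations -/

theorem mulVec_eq_sum_of_eigenbasis {k : ℕ} {A : Matrix (Fin k) (Fin k) ℝ}
    (v : OrthonormalBasis (Fin k) ℝ (EuclideanSpace ℝ (Fin k))) {lam : Fin k → ℝ}
    (hv : ∀ i, A.mulVec (v i).ofLp = lam i • (v i).ofLp) (x : EuclideanSpace ℝ (Fin k)) :
    Matrix.toEuclideanCLM (n := Fin k) (𝕜 := ℝ) A x = ∑ i, (lam i * inner ℝ (v i) x) • v i := by
  conv_lhs => rw [← v.sum_repr' x]
  rw [map_sum]
  refine Finset.sum_congr rfl fun i _ => ?_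
  have : Matrix.toEuclideanCLM (n := Fin k) (𝕜 := ℝ) A (v i) = lam i • v i := by
    ext1
    rw [Matrix.ofLp_toEuclideanCLM, hv i, WithLp.ofLp_smul]
  rw [map_smul, this, smul_smul, mul_comm]

theorem opNorm_le_of_eigenbasis {k : ℕ} {A : Matrix (Fin k) (Fin k) ℝ}
    (v : OrthonormalBasis (Fin k) ℝ (EuclideanSpace ℝ (Fin k))) {lam : Fin k → ℝ}
    (hv : ∀ i, A.mulVec (v i).ofLp = lam i • (v i).ofLp) {c : ℝ} (hc : 0 ≤ c)
    (h : ∀ i, |lam i| ≤ c) : opNorm A ≤ c := by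
  rw [opNorm_eq_norm_toEuclideanCLM]
  refine ContinuousLinearMap.opNorm_le_bound _ hc fun x => ?_
  refine le_of_sq_le_sq ?_ (by positivity)
  rw [mul_pow, ← v.sum_sq_inner_right, ← v.sum_sq_inner_right, Finset.mul_sum]
  refine Finset.sum_le_sum fun i _ => ?_
  rw [mulVec_eq_sum_of_eigenbasis v hv, v.orthonormal.inner_right_fintype, mul_pow]
  exact mul_le_mul_of_nonneg_right
    (sq_le_sq' (neg_le_of_abs_le (h i)) (le_of_abs_le (h i))) (sq_nonneg _)

theorem dotProduct_mulVec_of_eigenbasis {k : ℕ} {A : Matrix (Fin k) (Fin k) ℝ}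
    (v : OrthonormalBasis (Fin k) ℝ (EuclideanSpace ℝ (Fin k))) {lam : Fin k → ℝ}
    (hv : ∀ i, A.mulVec (v i).ofLp = lam i • (v i).ofLp) (x : EuclideanSpace ℝ (Fin k)) :
    x.ofLp ⬝ᵥ A.mulVec x.ofLp = ∑ i, lam i * inner ℝ (v i) x ^ 2 := by
  rw [← Matrix.inner_toEuclideanCLM, mulVec_eq_sum_of_eigenbasis v hv, inner_sum]
  refine Finset.sum_congr rfl fun i _ => ?_
  rw [inner_smul_right, real_inner_comm]
  ring

/-- Eckart–Young lower bound: for `d ≤ i` the span of `v 0, …, v i` meets the kernel of every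
matrix `K` of rank at most `d`, and on that span the quadratic form of `A` is at least `lam i`. -/
theorem le_opNorm_sub_of_rank_le {k d : ℕ} {A K : Matrix (Fin k) (Fin k) ℝ}
    (v : OrthonormalBasis (Fin k) ℝ (EuclideanSpace ℝ (Fin k))) {lam : Fin k → ℝ}
    (hlam : Antitone lam) (hv : ∀ i, A.mulVec (v i).ofLp = lam i • (v i).ofLp)
    (hK : K.rank ≤ d) {i : Fin k} (hi : d ≤ i) : lam i ≤ opNorm (A - K) := by
  classical
  let T := Matrix.toEuclideanLin (𝕜 := ℝ) K
  let S : Submodule ℝ (EuclideanSpace ℝ (Fin k)) :=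
    Submodule.span ℝ ((Finset.Iic i).image v : Finset (EuclideanSpace ℝ (Fin k)))
  have hS : Module.finrank ℝ S = i + 1 := by
    have hli : LinearIndepOn ℝ id
        (((Finset.Iic i).image v : Finset (EuclideanSpace ℝ (Fin k))) :
          Set (EuclideanSpace ℝ (Fin k))) := by
      refine v.orthonormal.linearIndependent.linearIndepOn_id.mono ?_
      simp
    rw [finrank_span_finset_eq_card hli,
      Finset.card_image_of_injective _ v.orthonormal.linearIndependent.injective, Fin.card_Iic]
  have hr : Module.finrank ℝ (LinearMap.range T) = K.rank := by
    rw [K.rank_eq_finrank_range_toLin (PiLp.basisFun 2 ℝ (Fin k)) (PiLp.basisFun 2 ℝ (Fin k)),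
      ← Matrix.toLpLin_eq_toLin]
  have hker := LinearMap.finrank_range_add_finrank_ker T
  have hnd : ¬ Disjoint S (LinearMap.ker T) := by
    intro hd
    have := Submodule.finrank_add_finrank_le_of_disjoint hd
    rw [finrank_euclideanSpace_fin] at this hker
    omega
  obtain ⟨x, hxS, hxK, hx0⟩ : ∃ x ∈ S, x ∈ LinearMap.ker T ∧ x ≠ 0 := by
    by_contra! hcon
    exact hnd (Submodule.disjoint_def.2 hcon)
  have horth : ∀ j, i < j → inner ℝ (v j) x = 0 := by
    intro j hj
    have : S ≤ LinearMap.ker (innerSL ℝ (v j)).toLinearMap := by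
      refine Submodule.span_le.2 ?_
      intro y hy
      obtain ⟨l, hl, rfl⟩ := Finset.mem_image.1 (Finset.mem_coe.1 hy)
      exact v.orthonormal.2 (ne_of_gt (lt_of_le_of_lt (Finset.mem_Iic.1 hl) hj))
    exact this hxS
  have hKx : K.mulVec x.ofLp = 0 := congrArg WithLp.ofLp (LinearMap.mem_ker.1 hxK)
  have hlow : lam i * ‖x‖ ^ 2 ≤ x.ofLp ⬝ᵥ (A - K).mulVec x.ofLp := by
    rw [Matrix.sub_mulVec, hKx, sub_zero, dotProduct_mulVec_of_eigenbasis v hv,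
      ← v.sum_sq_inner_right, Finset.mul_sum]
    refine Finset.sum_le_sum fun j _ => ?_
    rcases le_or_gt j i with hj | hj
    · exact mul_le_mul_of_nonneg_right (hlam hj) (sq_nonneg _)
    · simp [horth j hj]
  have hup := (le_abs_self _).trans (abs_dotProduct_mulVec_le (A - K) x x)
  have hpos : 0 < ‖x‖ ^ 2 := by have := norm_pos_iff.2 hx0; positivity
  refine le_of_mul_le_mul_right (hlow.trans (hup.trans_eq ?_)) hpos
  ring

theorem neg_le_opNorm_sub_of_posSemidef {k : ℕ} {A K : Matrix (Fin k) (Fin k) ℝ}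
    {x : EuclideanSpace ℝ (Fin k)} (hx : ‖x‖ = 1) {l : ℝ} (hA : A.mulVec x.ofLp = l • x.ofLp)
    (hK : K.PosSemidef) : -l ≤ opNorm (A - K) := by
  have h := (neg_abs_le _).trans' (neg_le_neg (abs_dotProduct_mulVec_le (A - K) x x))
  have hK' : 0 ≤ x.ofLp ⬝ᵥ K.mulVec x.ofLp := by
    simpa using hK.dotProduct_mulVec_nonneg x.ofLp
  have hxx : x.ofLp ⬝ᵥ x.ofLp = 1 := by
    have := EuclideanSpace.inner_eq_star_dotProduct x x
    rw [real_inner_self_eq_norm_sq, hx] at this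
    simpa using this.symm
  rw [Matrix.sub_mulVec, dotProduct_sub, hA, dotProduct_smul, hxx, hx] at h
  simp only [smul_eq_mul, mul_one] at h
  linarith

/-- The difference `A - H` is diagonal in the eigenbasis of `A`, with entries `min (lam i) 0` for
`i < d` and `lam i` otherwise, whose absolute values are lower bounds for the distance of `A` to any
competitor. -/
theorem spectralTruncations_subset_psdRankArgmin {k : ℕ} (d : ℕ) (A : Matrix (Fin k) (Fin k) ℝ) :
    spectralTruncations d A ⊆ psdRankArgmin d A := by
  rintro H ⟨v, lam, hlam, hv, rfl⟩
  have hsq : ∀ i, Real.sqrt (max (lam i) 0) ^ 2 = max (lam i) 0 :=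
    fun i => Real.sq_sqrt (le_max_right _ _)
  simp only [hsq]
  set H := ∑ i : Fin k with i.val < d, max (lam i) 0 • Matrix.vecMulVec (v i).ofLp (v i).ofLp
    with hH
  have hdot : ∀ i j, (v i).ofLp ⬝ᵥ (v j).ofLp = if i = j then 1 else 0 := by
    intro i j
    rw [← orthonormal_iff_ite.1 v.orthonormal i j, EuclideanSpace.inner_eq_star_dotProduct,
      dotProduct_comm]
    simp
  have hmul : ∀ x : Fin k → ℝ, H.mulVec x =
      ∑ i : Fin k with i.val < d, (max (lam i) 0 * ((v i).ofLp ⬝ᵥ x)) • (v i).ofLp := by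
    intro x
    rw [hH, Matrix.sum_mulVec]
    refine Finset.sum_congr rfl fun i _ => ?_
    rw [Matrix.smul_mulVec, Matrix.vecMulVec_mulVec, op_smul_eq_smul, smul_smul]
  have hHv : ∀ j, H.mulVec (v j).ofLp = (if j.val < d then max (lam j) 0 else 0) • (v j).ofLp := by
    intro j
    rw [hmul, Finset.sum_filter]
    rw [Finset.sum_eq_single j]
    · simp [hdot]
    · intro i _ hij
      simp [hdot, hij]
    · simp
  refine ⟨?_, ?_, ?_⟩
  · refine Matrix.posSemidef_sum _ fun i _ => ?_
    exact (Matrix.posSemidef_vecMulVec_self_star (v i).ofLp).smul (le_max_right _ _)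
  · classical
    have hle : LinearMap.range H.mulVecLin ≤ Submodule.span ℝ
        (((Finset.univ.filter fun i : Fin k => i.val < d).image fun i => (v i).ofLp :
          Finset (Fin k → ℝ)) : Set (Fin k → ℝ)) := by
      rintro _ ⟨x, rfl⟩
      rw [Matrix.mulVecLin_apply, hmul]
      refine Submodule.sum_mem _ fun i hi => Submodule.smul_mem _ _ (Submodule.subset_span ?_)
      exact Finset.mem_coe.2 (Finset.mem_image_of_mem _ hi)
    calc H.rank ≤ _ := Submodule.finrank_mono hle
      _ ≤ _ := finrank_span_finset_le_card _
      _ ≤ _ := Finset.card_image_le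
      _ ≤ (Finset.range d).card := Finset.card_le_card_of_injOn (fun i => i.val)
          (fun i hi => by simpa using hi) (fun i _ j _ h => Fin.ext h)
      _ = d := Finset.card_range d
  · intro K hK hKd
    refine opNorm_le_of_eigenbasis v
      (lam := fun i => lam i - if i.val < d then max (lam i) 0 else 0) (fun i => ?_)
      (opNorm_nonneg _) (fun i => ?_)
    · rw [Matrix.sub_mulVec, hv, hHv, sub_smul]
    · have hneg := neg_le_opNorm_sub_of_posSemidef (v.norm_eq_one i) (hv i) hK
      have h0 := opNorm_nonneg (A - K)
      split_ifs with hi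
      · rcases le_total (lam i) 0 with h | h
        · rw [max_eq_right h, sub_zero, abs_of_nonpos h]
          exact hneg
        · rw [max_eq_left h, sub_self, abs_zero]
          exact h0
      · rw [sub_zero]
        exact abs_le.2 ⟨by linarith, le_opNorm_sub_of_rank_le v hlam hv hKd (not_lt.1 hi)⟩

theorem spectralTruncations_nonempty {k : ℕ} (d : ℕ) {A : Matrix (Fin k) (Fin k) ℝ}
    (hA : A.IsHermitian) : (spectralTruncations d A).Nonempty := by
  have hs := Matrix.isSymmetric_toEuclideanLin_iff.2 hA
  have hn : Module.finrank ℝ (EuclideanSpace ℝ (Fin k)) = k := finrank_euclideanSpace_fin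
  exact ⟨_, hs.eigenvectorBasis hn, hs.eigenvalues hn, hs.eigenvalues_antitone hn,
    fun i => congrArg WithLp.ofLp (hs.apply_eigenvectorBasis hn i), rfl⟩

theorem gramEstimator_isHermitian {d k N : ℕ} (σ : ℝ) (Y : Fin N → Matrix (Fin d) (Fin k) ℝ) :
    (gramEstimator σ Y).IsHermitian := by
  have h : ∀ M : Matrix (Fin d) (Fin k) ℝ, (M.transpose * M).IsHermitian :=
    fun M => Matrix.isHermitian_conjTranspose_mul_self M
  simp only [Matrix.IsHermitian, gramEstimator, Matrix.conjTranspose_sub, Matrix.conjTranspose_smul,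
    Matrix.conjTranspose_sum, Matrix.conjTranspose_one, (h _).eq, star_trivial]

/-! ### The moment generating function of one observation -/

/-- Moment generating function of a scaled noncentral chi-square variable with one degree of
freedom, by completing the square. -/
theorem integral_exp_mul_sq_gaussianReal {t σ : ℝ} (ht : 0 < 1 - 2 * t * σ ^ 2) (a : ℝ) :
    ∫ x, Real.exp (t * (a + σ * x) ^ 2) ∂gaussianReal 0 1 =
      (Real.sqrt (1 - 2 * t * σ ^ 2))⁻¹ * Real.exp (t * a ^ 2 / (1 - 2 * t * σ ^ 2)) := by
  set q := 1 - 2 * t * σ ^ 2 with hq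
  rw [integral_gaussianReal_eq_integral_smul one_ne_zero]
  have e : ∀ x : ℝ, gaussianPDFReal 0 1 x • Real.exp (t * (a + σ * x) ^ 2) =
      ((Real.sqrt (2 * Real.pi))⁻¹ * Real.exp (t * a ^ 2 / q)) *
        Real.exp (-(q / 2) * (x - 2 * t * a * σ / q) ^ 2) := by
    intro x
    rw [gaussianPDFReal, smul_eq_mul, mul_assoc, mul_assoc (Real.sqrt (2 * Real.pi))⁻¹,
      ← Real.exp_add, ← Real.exp_add]
    congr 2
    · simp
    · simp only [NNReal.coe_one, sub_zero, mul_one]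
      field_simp
      rw [hq]
      ring
  simp_rw [e]
  rw [integral_const_mul, integral_sub_right_eq_self (fun x : ℝ => Real.exp (-(q / 2) * x ^ 2)),
    integral_gaussian]
  have : Real.pi / (q / 2) = 2 * Real.pi * q⁻¹ := by field_simp
  rw [this, Real.sqrt_mul (by positivity) q⁻¹, Real.sqrt_inv]
  have : Real.sqrt (2 * Real.pi) ≠ 0 := by positivity
  field_simp

/-- A unit linear combination of independent standard Gaussians is standard Gaussian. -/
theorem map_dotProduct_pi_gaussianReal {k : ℕ} {u : EuclideanSpace ℝ (Fin k)} (hu : ‖u‖ = 1) :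
    (Measure.pi fun _ : Fin k => gaussianReal 0 1).map (fun x => x ⬝ᵥ u.ofLp) =
      gaussianReal 0 1 := by
  have hcomp : (fun x : Fin k → ℝ => x ⬝ᵥ u.ofLp) =
      (fun y : EuclideanSpace ℝ (Fin k) => innerSL ℝ u y) ∘ WithLp.toLp 2 := by
    ext x
    simp [EuclideanSpace.inner_eq_star_dotProduct]
  refine Measure.ext_of_charFun ?_
  ext s
  rw [hcomp, ← Measure.map_map (by fun_prop) (by fun_prop), map_pi_eq_stdGaussian]
  rw [charFun_apply, integral_map (by fun_prop) (by fun_prop), charFun_gaussianReal]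
  have := charFun_stdGaussian (E := EuclideanSpace ℝ (Fin k)) (s • u)
  rw [charFun_apply] at this
  convert this using 2
  · ext y
    simp [inner_smul_right, real_inner_comm]
  · have hs : ((|s| : ℝ) : ℂ) ^ 2 = (s : ℂ) ^ 2 := by
      rw [← Complex.ofReal_pow, sq_abs, Complex.ofReal_pow]
    rw [norm_smul, hu, mul_one, Real.norm_eq_abs, hs]
    simp [neg_div]

theorem map_mulVec_stdGaussianMatrix {d k : ℕ} {u : EuclideanSpace ℝ (Fin k)} (hu : ‖u‖ = 1) :
    (stdGaussianMatrix d k).map (fun E => E.mulVec u.ofLp) =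
      Measure.pi fun _ : Fin d => gaussianReal 0 1 := by
  have hm : Measurable fun x : Fin k → ℝ => x ⬝ᵥ u.ofLp := by
    unfold dotProduct
    fun_prop
  have h := Measure.pi_map_pi (ι := Fin d) (X := fun _ => Fin k → ℝ) (Y := fun _ => ℝ)
    (μ := fun _ => Measure.pi fun _ : Fin k => gaussianReal 0 1)
    (f := fun _ x => x ⬝ᵥ u.ofLp)
    (hμ := fun _ => by rw [map_dotProduct_pi_gaussianReal hu]; infer_instance)
    (fun _ => hm.aemeasurable)
  simp only [map_dotProduct_pi_gaussianReal hu] at h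
  exact h

theorem measurable_mulVec {d k : ℕ} (u : Fin k → ℝ) :
    Measurable fun M : Matrix (Fin d) (Fin k) ℝ => M.mulVec u := by
  refine measurable_pi_lambda _ fun i => ?_
  simp only [Matrix.mulVec, dotProduct]
  exact Finset.measurable_sum _ fun j _ =>
    ((measurable_pi_apply j).comp (measurable_pi_apply i)).mul_const _

theorem measurable_dotProduct_mulVec {d k : ℕ} (u : Fin k → ℝ) :
    Measurable fun M : Matrix (Fin d) (Fin k) ℝ => M.mulVec u ⬝ᵥ M.mulVec u := by
  simp only [dotProduct]
  exact Finset.measurable_sum _ fun i _ =>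
    ((measurable_pi_apply i).comp (measurable_mulVec u)).mul
      ((measurable_pi_apply i).comp (measurable_mulVec u))

theorem integral_exp_stdGaussianMatrix {d k : ℕ} {t σ : ℝ} (ht : 0 < 1 - 2 * t * σ ^ 2)
    (M : Matrix (Fin d) (Fin k) ℝ) {u : EuclideanSpace ℝ (Fin k)} (hu : ‖u‖ = 1) :
    ∫ E, Real.exp (t * ((M + σ • E).mulVec u.ofLp ⬝ᵥ (M + σ • E).mulVec u.ofLp))
        ∂stdGaussianMatrix d k =
      (Real.sqrt (1 - 2 * t * σ ^ 2))⁻¹ ^ d *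
        Real.exp (t * (M.mulVec u.ofLp ⬝ᵥ M.mulVec u.ofLp) / (1 - 2 * t * σ ^ 2)) := by
  have e : ∀ E : Matrix (Fin d) (Fin k) ℝ,
      Real.exp (t * ((M + σ • E).mulVec u.ofLp ⬝ᵥ (M + σ • E).mulVec u.ofLp)) =
      (fun g : Fin d → ℝ => ∏ i, Real.exp (t * (M.mulVec u.ofLp i + σ * g i) ^ 2))
        (E.mulVec u.ofLp) := by
    intro E
    simp only [← Real.exp_sum, ← Finset.mul_sum, dotProduct, Matrix.add_mulVec,
      Matrix.smul_mulVec, Pi.add_apply, Pi.smul_apply, smul_eq_mul, sq]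
  rw [integral_congr_ae (Filter.Eventually.of_forall e)]
  refine (integral_map (measurable_mulVec (d := d) u.ofLp).aemeasurable
    (f := fun g : Fin d → ℝ => ∏ i, Real.exp (t * (M.mulVec u.ofLp i + σ * g i) ^ 2))
    (Measurable.aestronglyMeasurable (by fun_prop))).symm.trans ?_
  rw [map_mulVec_stdGaussianMatrix hu,
    integral_fintype_prod_eq_prod
      (fun i (x : ℝ) => Real.exp (t * (M.mulVec u.ofLp i + σ * x) ^ 2))]
  simp_rw [integral_exp_mul_sq_gaussianReal ht]
  rw [Finset.prod_mul_distrib, Finset.prod_const, Finset.card_univ, Fintype.card_fin,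
    ← Real.exp_sum, ← Finset.sum_div, ← Finset.mul_sum]
  simp only [dotProduct, sq]

theorem dotProduct_orthogonal_mul_mulVec {d k : ℕ} (Q : Matrix.orthogonalGroup (Fin d) ℝ)
    (X : Matrix (Fin d) (Fin k) ℝ) (u : Fin k → ℝ) :
    ((Q : Matrix (Fin d) (Fin d) ℝ) * X).mulVec u ⬝ᵥ
      ((Q : Matrix (Fin d) (Fin d) ℝ) * X).mulVec u = X.mulVec u ⬝ᵥ X.mulVec u := by
  have hQ : (Q : Matrix (Fin d) (Fin d) ℝ).transpose * Q = 1 :=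
    (Matrix.mem_orthogonalGroup_iff' (Fin d) ℝ).1 Q.2
  rw [← Matrix.mulVec_mulVec, Matrix.dotProduct_mulVec, ← Matrix.mulVec_transpose,
    Matrix.mulVec_mulVec, hQ, Matrix.one_mulVec]

/-- Conditionally on the rotation, `‖Y u‖²` is a scaled noncentral chi-square variable whose law
does not depend on that rotation. -/
theorem integral_exp_observationLaw {d k : ℕ} {t σ : ℝ} (ht : 0 < 1 - 2 * t * σ ^ 2)
    (ν : Measure (Matrix.orthogonalGroup (Fin d) ℝ)) [IsProbabilityMeasure ν]
    (X : Matrix (Fin d) (Fin k) ℝ) {u : EuclideanSpace ℝ (Fin k)} (hu : ‖u‖ = 1) :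
    ∫ M, Real.exp (t * (M.mulVec u.ofLp ⬝ᵥ M.mulVec u.ofLp)) ∂observationLaw ν X σ =
      (Real.sqrt (1 - 2 * t * σ ^ 2))⁻¹ ^ d *
        Real.exp (t * (X.mulVec u.ofLp ⬝ᵥ X.mulVec u.ofLp) / (1 - 2 * t * σ ^ 2)) := by
  have hm : Measurable fun M : Matrix (Fin d) (Fin k) ℝ =>
      Real.exp (t * (M.mulVec u.ofLp ⬝ᵥ M.mulVec u.ofLp)) :=
    ((measurable_dotProduct_mulVec u.ofLp).const_mul t).exp
  rw [observationLaw, integral_map (measurable_observation X σ).aemeasurable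
    hm.aestronglyMeasurable]
  have hm' := hm.comp (measurable_observation X σ)
  have hval : ∀ Q : Matrix.orthogonalGroup (Fin d) ℝ, _ := fun Q =>
    integral_exp_stdGaussianMatrix ht ((Q : Matrix (Fin d) (Fin d) ℝ) * X) hu
  simp only [dotProduct_orthogonal_mul_mulVec] at hval
  have hq : 0 < Real.sqrt (1 - 2 * t * σ ^ 2) := Real.sqrt_pos.2 ht
  have hint : ∀ Q : Matrix.orthogonalGroup (Fin d) ℝ, Integrable (fun E =>
      Real.exp (t * (((Q : Matrix (Fin d) (Fin d) ℝ) * X + σ • E).mulVec u.ofLp ⬝ᵥ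
        ((Q : Matrix (Fin d) (Fin d) ℝ) * X + σ • E).mulVec u.ofLp)))
      (stdGaussianMatrix d k) := by
    intro Q
    by_contra hcon
    have := hval Q
    rw [integral_undef hcon] at this
    exact absurd this (by positivity)
  rw [integral_prod]
  · simp only [hval, integral_const, probReal_univ, one_smul]
  · refine (integrable_prod_iff hm'.aestronglyMeasurable).2 ⟨Filter.Eventually.of_forall hint, ?_⟩
    simp only [Function.comp_apply, Real.norm_of_nonneg (Real.exp_pos _).le, hval]
    exact integrable_const _

/-- With `z = (1 - x)⁻¹` the inequality for `0 ≤ x` reads `log z ≤ sinh (log z)`. -/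
theorem neg_log_one_sub_sub_le {x : ℝ} (hx : |x| < 1) :
    -Real.log (1 - x) - x ≤ x ^ 2 / (2 * (1 - |x|)) := by
  rcases le_total 0 x with h | h
  · rw [abs_of_nonneg h] at hx ⊢
    have hz : 0 < (1 - x)⁻¹ := inv_pos.2 (by linarith)
    have h1 : 0 ≤ Real.log (1 - x)⁻¹ :=
      Real.log_nonneg ((one_le_inv₀ (by linarith)).2 (by linarith))
    have h2 := Real.self_le_sinh_iff.2 h1
    rw [Real.sinh_log hz, Real.log_inv, inv_inv] at h2
    have e : ((1 - x)⁻¹ - (1 - x)) / 2 = x + x ^ 2 / (2 * (1 - x)) := by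
      have : 1 - x ≠ 0 := by linarith
      field_simp
      ring
    linarith
  · rw [abs_of_nonpos h] at hx ⊢
    have h1 := Real.le_log_one_add_of_nonneg (neg_nonneg.2 h)
    rw [← sub_eq_add_neg] at h1
    have e : 2 * -x / (-x + 2) = -x - x ^ 2 / (-x + 2) := by
      have : -x + 2 ≠ 0 := by linarith
      field_simp
      ring
    have h2 : x ^ 2 / (-x + 2) ≤ x ^ 2 / (2 * (1 - -x)) := by
      have : 0 < 2 * (1 - -x) := by linarith
      gcongr
      linarith
    linarith

/-- For `a = ‖X u‖²` the left-hand side is the moment generating function of the centred variable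
`‖Y u‖² - ‖X u‖² - d σ²`, which is thus sub-gamma on both sides with scale `2 σ²`. -/
theorem centred_mgf_le {d : ℕ} {t σ a V : ℝ} (ht : 2 * |t| * σ ^ 2 < 1) (ha : 0 ≤ a)
    (hV : 2 * a * σ ^ 2 + d * σ ^ 4 ≤ V) :
    (Real.sqrt (1 - 2 * t * σ ^ 2))⁻¹ ^ d * Real.exp (t * a / (1 - 2 * t * σ ^ 2)) *
      Real.exp (-(t * (a + d * σ ^ 2))) ≤ Real.exp (t ^ 2 * V / (1 - 2 * |t| * σ ^ 2)) := by
  have habs : |2 * t * σ ^ 2| = 2 * |t| * σ ^ 2 := by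
    rw [abs_mul, abs_mul, abs_of_nonneg (sq_nonneg σ), abs_two]
  have hlog := neg_log_one_sub_sub_le (x := 2 * t * σ ^ 2) (by rwa [habs])
  have hle := le_abs_self (2 * t * σ ^ 2)
  rw [habs] at hlog hle
  set r := 1 - 2 * |t| * σ ^ 2 with hr
  set q := 1 - 2 * t * σ ^ 2 with hq
  have hr0 : 0 < r := by linarith
  have hrq : r ≤ q := by linarith
  have hq0 : 0 < q := hr0.trans_le hrq
  have hsqrt : (Real.sqrt q)⁻¹ ^ d = Real.exp (d * (-Real.log q / 2)) := by
    rw [Real.exp_nat_mul, neg_div, Real.exp_neg, ← Real.log_sqrt hq0.le,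
      Real.exp_log (Real.sqrt_pos.2 hq0)]
  rw [hsqrt, ← Real.exp_add, ← Real.exp_add, Real.exp_le_exp]
  have h1 : t * a / q - t * a = t ^ 2 * (2 * a * σ ^ 2) / q := by
    field_simp
    rw [hq]
    ring
  have h2 : t ^ 2 * (2 * a * σ ^ 2) / q ≤ t ^ 2 * (2 * a * σ ^ 2) / r := by gcongr
  have h3 : (d : ℝ) * ((-Real.log q - 2 * t * σ ^ 2) / 2) ≤
      d * (((2 * t * σ ^ 2) ^ 2 / (2 * r)) / 2) := by gcongr
  have h4 : (d : ℝ) * (((2 * t * σ ^ 2) ^ 2 / (2 * r)) / 2) = t ^ 2 * (d * σ ^ 4) / r := by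
    field_simp
  have h5 : t ^ 2 * (2 * a * σ ^ 2) / r + t ^ 2 * (d * σ ^ 4) / r ≤ t ^ 2 * V / r := by
    rw [← add_div, ← mul_add]
    gcongr
  linarith

/-! ### Concentration of the Gram estimator -/

theorem dotProduct_transpose_mul_mulVec {d k : ℕ} (M : Matrix (Fin d) (Fin k) ℝ) (u : Fin k → ℝ) :
    u ⬝ᵥ (M.transpose * M).mulVec u = M.mulVec u ⬝ᵥ M.mulVec u := by
  rw [← Matrix.mulVec_mulVec, Matrix.dotProduct_mulVec, Matrix.vecMul_transpose]

theorem dotProduct_mulVec_self_le {d k : ℕ} (X : Matrix (Fin d) (Fin k) ℝ)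
    {u : EuclideanSpace ℝ (Fin k)} (hu : ‖u‖ = 1) :
    X.mulVec u.ofLp ⬝ᵥ X.mulVec u.ofLp ≤ opNorm X ^ 2 := by
  have h := norm_toLp_mulVec_le X u
  rw [hu, mul_one] at h
  have e : X.mulVec u.ofLp ⬝ᵥ X.mulVec u.ofLp = ‖WithLp.toLp 2 (X.mulVec u.ofLp)‖ ^ 2 := by
    rw [EuclideanSpace.real_norm_sq_eq]
    simp [dotProduct, sq]
  rw [e]
  gcongr

theorem dotProduct_gramEstimator_sub_mulVec {d k N : ℕ} (hN : 0 < N) (σ : ℝ)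
    (Y : Fin N → Matrix (Fin d) (Fin k) ℝ) (X : Matrix (Fin d) (Fin k) ℝ)
    {u : EuclideanSpace ℝ (Fin k)} (hu : ‖u‖ = 1) :
    N * (u.ofLp ⬝ᵥ (gramEstimator σ Y - X.transpose * X).mulVec u.ofLp) =
      ∑ i, ((Y i).mulVec u.ofLp ⬝ᵥ (Y i).mulVec u.ofLp -
        (X.mulVec u.ofLp ⬝ᵥ X.mulVec u.ofLp + d * σ ^ 2)) := by
  have huu : u.ofLp ⬝ᵥ u.ofLp = 1 := by
    have := EuclideanSpace.real_norm_sq_eq u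
    rw [hu] at this
    simpa [dotProduct, sq] using this.symm
  have hN' : (N : ℝ) ≠ 0 := by positivity
  simp only [gramEstimator, Matrix.sub_mulVec, dotProduct_sub, Matrix.smul_mulVec, dotProduct_smul,
    Matrix.one_mulVec, huu, Matrix.sum_mulVec, dotProduct_sum, dotProduct_transpose_mul_mulVec,
    smul_eq_mul, Finset.sum_sub_distrib, Finset.sum_const, Finset.card_univ, Fintype.card_fin,
    nsmul_eq_mul]
  field_simp
  ring

/-- The sum of the centred quadratic forms is sub-gamma on both sides. Integrability comes for free:
the product of the individual moment generating functions is positive. -/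
theorem mgf_sum_centred_le {d k N : ℕ} (X : Matrix (Fin d) (Fin k) ℝ) (σ : ℝ)
    (ν : Measure (Matrix.orthogonalGroup (Fin d) ℝ)) [IsProbabilityMeasure ν]
    {Ω : Type*} [MeasurableSpace Ω] (P : Measure Ω) [IsProbabilityMeasure P]
    (Y : Fin N → Ω → Matrix (Fin d) (Fin k) ℝ) (hindep : iIndepFun Y P)
    (hlaw : ∀ i, HasLaw (Y i) (observationLaw ν X σ) P)
    {u : EuclideanSpace ℝ (Fin k)} (hu : ‖u‖ = 1) {t : ℝ} (ht : 2 * |t| * σ ^ 2 < 1) :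
    let W : Ω → ℝ := fun ω => ∑ i, ((Y i ω).mulVec u.ofLp ⬝ᵥ (Y i ω).mulVec u.ofLp -
        (X.mulVec u.ofLp ⬝ᵥ X.mulVec u.ofLp + d * σ ^ 2))
    Integrable (fun ω => Real.exp (t * W ω)) P ∧
      mgf W P t ≤ Real.exp (N * (t ^ 2 * (2 * opNorm X ^ 2 * σ ^ 2 + d * σ ^ 4) /
        (1 - 2 * |t| * σ ^ 2))) := by
  intro W
  set a := X.mulVec u.ofLp ⬝ᵥ X.mulVec u.ofLp with ha
  have ha0 : 0 ≤ a := by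
    simp only [ha, dotProduct, ← sq]
    positivity
  have hq : 0 < 1 - 2 * t * σ ^ 2 := by
    have : 2 * t * σ ^ 2 ≤ 2 * |t| * σ ^ 2 := by
      gcongr
      exact le_abs_self t
    linarith
  let g : Matrix (Fin d) (Fin k) ℝ → ℝ := fun M =>
    M.mulVec u.ofLp ⬝ᵥ M.mulVec u.ofLp - (a + d * σ ^ 2)
  have hg : Measurable g := (measurable_dotProduct_mulVec u.ofLp).sub_const _
  have hmgf : ∀ i, mgf (fun ω => g (Y i ω)) P t =
      (Real.sqrt (1 - 2 * t * σ ^ 2))⁻¹ ^ d * Real.exp (t * a / (1 - 2 * t * σ ^ 2)) *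
        Real.exp (-(t * (a + d * σ ^ 2))) := by
    intro i
    have h1 := (hlaw i).integral_comp (f := fun M => Real.exp (t * g M))
      (hg.const_mul t).exp.aestronglyMeasurable
    have h2 : ∀ M : Matrix (Fin d) (Fin k) ℝ, Real.exp (t * g M) =
        Real.exp (t * (M.mulVec u.ofLp ⬝ᵥ M.mulVec u.ofLp)) *
          Real.exp (-(t * (a + d * σ ^ 2))) := by
      intro M
      rw [← Real.exp_add]
      congr 1
      simp only [g]
      ring
    simp only [h2, integral_mul_const, integral_exp_observationLaw hq ν X hu] at h1
    rw [mgf, ← h1]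
    simp only [h2, Function.comp_def, integral_mul_const]
  have hW : W = ∑ i, fun ω => g (Y i ω) := by
    ext ω
    simp only [W, g, ha, Finset.sum_apply]
  have hprod : mgf W P t = ∏ i, mgf (fun ω => g (Y i ω)) P t := by
    rw [hW]
    exact (hindep.comp (fun _ => g) (fun _ => hg)).mgf_sum₀
      (fun i => hg.comp_aemeasurable (hlaw i).aemeasurable) Finset.univ
  simp only [hmgf, Finset.prod_const, Finset.card_univ, Fintype.card_fin] at hprod
  have hsq : 0 < Real.sqrt (1 - 2 * t * σ ^ 2) := Real.sqrt_pos.2 hq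
  constructor
  · by_contra hcon
    rw [mgf, integral_undef hcon] at hprod
    exact absurd hprod.symm (by positivity)
  · rw [hprod, Real.exp_nat_mul]
    refine pow_le_pow_left₀ (by positivity) (centred_mgf_le ht ha0 ?_) N
    have := dotProduct_mulVec_self_le X hu
    gcongr

/-- Bernstein-type tail bound for the quadratic form of the estimation error. -/
theorem measure_quadratic_form_ge_le {d k N : ℕ} (hN : 0 < N) (hd : 0 < d)
    (X : Matrix (Fin d) (Fin k) ℝ) {σ : ℝ} (hσ : 0 < σ)
    (ν : Measure (Matrix.orthogonalGroup (Fin d) ℝ)) [IsProbabilityMeasure ν]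
    {Ω : Type*} [MeasurableSpace Ω] (P : Measure Ω) [IsProbabilityMeasure P]
    (Y : Fin N → Ω → Matrix (Fin d) (Fin k) ℝ) (hindep : iIndepFun Y P)
    (hlaw : ∀ i, HasLaw (Y i) (observationLaw ν X σ) P)
    {u : EuclideanSpace ℝ (Fin k)} (hu : ‖u‖ = 1) {s : ℝ} (hs : 0 ≤ s) :
    P.real {ω | 2 * (Real.sqrt ((2 * opNorm X ^ 2 * σ ^ 2 + d * σ ^ 4) / N * s) +
        σ ^ 2 / N * s) ≤
      |u.ofLp ⬝ᵥ (gramEstimator σ (fun i => Y i ω) - X.transpose * X).mulVec u.ofLp|} ≤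
      2 * Real.exp (-s) := by
  set V := 2 * opNorm X ^ 2 * σ ^ 2 + d * σ ^ 4 with hV
  have hV0 : 0 < V := by positivity
  have hN' : (0 : ℝ) < N := by positivity
  set b := Real.sqrt (V / N * s) + σ ^ 2 / N * s with hb
  let W : Ω → ℝ := fun ω => ∑ i, ((Y i ω).mulVec u.ofLp ⬝ᵥ (Y i ω).mulVec u.ofLp -
        (X.mulVec u.ofLp ⬝ᵥ X.mulVec u.ofLp + d * σ ^ 2))
  have hW : ∀ ω, (N : ℝ) * (u.ofLp ⬝ᵥ
      (gramEstimator σ (fun i => Y i ω) - X.transpose * X).mulVec u.ofLp) = W ω :=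
    fun ω => dotProduct_gramEstimator_sub_mulVec hN σ (fun i => Y i ω) X hu
  -- the minimizer of the Chernoff exponent for a sub-gamma variable
  obtain ⟨t, ht0, ht1, hexp⟩ : ∃ t : ℝ, 0 ≤ t ∧ 2 * t * σ ^ 2 < 1 ∧
      -t * (N * (2 * b)) + N * (t ^ 2 * V / (1 - 2 * t * σ ^ 2)) = -s := by
    have hp : 0 < Real.sqrt V := Real.sqrt_pos.2 hV0
    have hw : 0 ≤ Real.sqrt (s / N) := Real.sqrt_nonneg _
    have hb' : b = Real.sqrt V * Real.sqrt (s / N) + σ ^ 2 * Real.sqrt (s / N) ^ 2 := by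
      rw [← Real.sqrt_mul hV0.le, Real.sq_sqrt (by positivity), hb]
      congr 1
      · congr 1
        ring
      · ring
    have hs' : s = N * Real.sqrt (s / N) ^ 2 := by
      rw [Real.sq_sqrt (by positivity)]
      field_simp
    have hV' : V = Real.sqrt V ^ 2 := (Real.sq_sqrt hV0.le).symm
    generalize Real.sqrt V = p at *
    generalize Real.sqrt (s / N) = w at *
    have hD : 0 < p + 2 * σ ^ 2 * w := by positivity
    have h1 : 1 - 2 * (w / (p + 2 * σ ^ 2 * w)) * σ ^ 2 = p / (p + 2 * σ ^ 2 * w) := by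
      field_simp
      ring
    refine ⟨w / (p + 2 * σ ^ 2 * w), by positivity, ?_, ?_⟩
    · have : 0 < p / (p + 2 * σ ^ 2 * w) := by positivity
      linarith
    · rw [h1, hb', hV', hs']
      field_simp
      ring
  have habs : |t| = t := abs_of_nonneg ht0
  have hup := mgf_sum_centred_le X σ ν P Y hindep hlaw hu (t := t) (by rwa [habs])
  have hlo := mgf_sum_centred_le X σ ν P Y hindep hlaw hu (t := -t) (by rwa [abs_neg, habs])
  rw [habs] at hup
  rw [abs_neg, habs, neg_sq] at hlo
  have h1 : P.real {ω | N * (2 * b) ≤ W ω} ≤ Real.exp (-s) := by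
    refine (measure_ge_le_exp_mul_mgf _ ht0 hup.1).trans ?_
    rw [← hexp, Real.exp_add]
    exact mul_le_mul_of_nonneg_left hup.2 (Real.exp_pos _).le
  have h2 : P.real {ω | W ω ≤ -(N * (2 * b))} ≤ Real.exp (-s) := by
    refine (measure_le_le_exp_mul_mgf _ (neg_nonpos.2 ht0) hlo.1).trans ?_
    rw [← hexp, Real.exp_add, neg_mul_neg]
    exact mul_le_mul_of_nonneg_left hlo.2 (Real.exp_pos _).le
  have hsub : {ω | 2 * b ≤ |u.ofLp ⬝ᵥ
      (gramEstimator σ (fun i => Y i ω) - X.transpose * X).mulVec u.ofLp|} ⊆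
      {ω | N * (2 * b) ≤ W ω} ∪ {ω | W ω ≤ -(N * (2 * b))} := by
    intro ω hω
    rcases le_abs'.1 (Set.mem_ofPred_eq ▸ hω) with h | h
    · refine Or.inr ?_
      rw [Set.mem_ofPred_eq, ← hW, ← mul_neg]
      exact mul_le_mul_of_nonneg_left h hN'.le
    · refine Or.inl ?_
      rw [Set.mem_ofPred_eq, ← hW]
      exact mul_le_mul_of_nonneg_left h hN'.le
  calc _ ≤ _ := measureReal_mono hsub
    _ ≤ _ := measureReal_union_le _ _
    _ ≤ _ := by linarith

/-- Union bound over a net of the sphere with at most `9 ^ k / 2` elements. -/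
theorem measure_opNorm_gramEstimator_sub_gt_le {d k N : ℕ} (hN : 0 < N) (hd : 0 < d)
    (X : Matrix (Fin d) (Fin k) ℝ) {σ : ℝ} (hσ : 0 < σ)
    (ν : Measure (Matrix.orthogonalGroup (Fin d) ℝ)) [IsProbabilityMeasure ν]
    {Ω : Type*} [MeasurableSpace Ω] (P : Measure Ω) [IsProbabilityMeasure P]
    (Y : Fin N → Ω → Matrix (Fin d) (Fin k) ℝ) (hindep : iIndepFun Y P)
    (hlaw : ∀ i, HasLaw (Y i) (observationLaw ν X σ) P)
    {δ : ℝ} (hδ0 : 0 < δ) (hδ1 : δ < 1) :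
    P.real {ω | 4 * (Real.sqrt ((2 * opNorm X ^ 2 * σ ^ 2 + d * σ ^ 4) / N *
        (k * Real.log (10 / δ))) + σ ^ 2 / N * (k * Real.log (10 / δ))) <
      opNorm (gramEstimator σ (fun i => Y i ω) - X.transpose * X)} ≤ δ := by
  have hlog : 0 ≤ Real.log (10 / δ) :=
    Real.log_nonneg ((one_le_div hδ0).2 (by linarith))
  have hs : 0 ≤ k * Real.log (10 / δ) := by positivity
  set b := Real.sqrt ((2 * opNorm X ^ 2 * σ ^ 2 + d * σ ^ 4) / N *
        (k * Real.log (10 / δ))) + σ ^ 2 / N * (k * Real.log (10 / δ)) with hb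
  have hb0 : 0 ≤ b := by positivity
  obtain ⟨T, hcard, hT, hnet⟩ := exists_net_up_to_sign (EuclideanSpace ℝ (Fin k))
  rw [finrank_euclideanSpace_fin] at hcard
  have hsub : {ω | 4 * b < opNorm (gramEstimator σ (fun i => Y i ω) - X.transpose * X)} ⊆
      ⋃ u ∈ T, {ω | 2 * b ≤ |u.ofLp ⬝ᵥ
        (gramEstimator σ (fun i => Y i ω) - X.transpose * X).mulVec u.ofLp|} := by
    intro ω hω
    by_contra hcon
    simp only [Set.mem_iUnion, Set.mem_ofPred_eq, not_exists, not_le] at hcon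
    have hherm : (gramEstimator σ (fun i => Y i ω) - X.transpose * X).IsHermitian :=
      (gramEstimator_isHermitian σ _).sub (Matrix.isHermitian_conjTranspose_mul_self X)
    have := opNorm_le_of_net hherm hT hnet (c := 2 * b) (by positivity)
      fun y hy => (hcon y hy).le
    rw [Set.mem_ofPred_eq] at hω
    linarith
  have hexp : Real.exp (-(k * Real.log (10 / δ))) = (δ / 10) ^ k := by
    rw [← mul_neg, ← Real.log_inv, inv_div, Real.exp_nat_mul, Real.exp_log (by positivity)]
  calc _ ≤ _ := measureReal_mono hsub (measure_ne_top _ _)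
    _ ≤ ∑ u ∈ T, P.real {ω | 2 * b ≤ |u.ofLp ⬝ᵥ
        (gramEstimator σ (fun i => Y i ω) - X.transpose * X).mulVec u.ofLp|} :=
      measureReal_biUnion_finset_le _ _
    _ ≤ ∑ _u ∈ T, 2 * (δ / 10) ^ k := Finset.sum_le_sum fun u hu => by
      rw [← hexp]
      exact measure_quadratic_form_ge_le hN hd X hσ ν P Y hindep hlaw (hT u hu) hs
    _ = ((2 * T.card : ℕ) : ℝ) * (δ / 10) ^ k := by
      rw [Finset.sum_const, nsmul_eq_mul]
      push_cast
      ring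
    _ ≤ δ := by
      rcases Nat.eq_zero_or_pos k with rfl | hk
      -- in dimension `0` the sphere, hence the net, is empty
      · have : T.card = 0 := by omega
        simp [this, hδ0.le]
      · calc ((2 * T.card : ℕ) : ℝ) * (δ / 10) ^ k ≤ 9 ^ k * (δ / 10) ^ k := by
              gcongr
              exact mod_cast hcard
          _ = (9 * (δ / 10)) ^ k := (mul_pow _ _ _).symm
          _ ≤ 9 * (δ / 10) := pow_le_of_le_one (by positivity) (by linarith) hk.ne'
          _ ≤ δ := by linarith

/-- Without noise the estimator is exact. -/
theorem gramEstimator_ae_eq_of_zero_noise {d k N : ℕ} (hN : 0 < N)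
    (X : Matrix (Fin d) (Fin k) ℝ)
    (ν : Measure (Matrix.orthogonalGroup (Fin d) ℝ)) [IsProbabilityMeasure ν]
    {Ω : Type*} [MeasurableSpace Ω] (P : Measure Ω)
    (Y : Fin N → Ω → Matrix (Fin d) (Fin k) ℝ)
    (hlaw : ∀ i, HasLaw (Y i) (observationLaw ν X 0) P) :
    ∀ᵐ ω ∂P, gramEstimator 0 (fun i => Y i ω) = X.transpose * X := by
  have hmeas : MeasurableSet {M : Matrix (Fin d) (Fin k) ℝ |
      M.transpose * M = X.transpose * X} := by
    simp only [← Matrix.ext_iff, Set.ofPred_forall]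
    refine MeasurableSet.iInter fun i => MeasurableSet.iInter fun j => ?_
    refine measurableSet_eq_fun ?_ measurable_const
    simp only [Matrix.mul_apply, Matrix.transpose_apply]
    have hentry : ∀ l j, Measurable fun M : Matrix (Fin d) (Fin k) ℝ => M l j :=
      fun l j => (measurable_pi_apply j).comp (measurable_pi_apply l)
    exact Finset.measurable_sum _ fun l _ => (hentry l i).mul (hentry l j)
  have hY : ∀ i, ∀ᵐ ω ∂P, (Y i ω).transpose * Y i ω = X.transpose * X := by
    intro i
    refine ae_of_ae_map (hlaw i).aemeasurable
      (p := fun M => M.transpose * M = X.transpose * X) ?_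
    rw [(hlaw i).map_eq, observationLaw,
      ae_map_iff (measurable_observation X 0).aemeasurable hmeas]
    refine Filter.Eventually.of_forall fun p => ?_
    have hQ : (p.1 : Matrix (Fin d) (Fin d) ℝ).transpose * p.1 = 1 :=
      (Matrix.mem_orthogonalGroup_iff' (Fin d) ℝ).1 p.1.2
    rw [zero_smul, add_zero, Matrix.transpose_mul, Matrix.mul_assoc,
      ← Matrix.mul_assoc _ (p.1 : Matrix (Fin d) (Fin d) ℝ) X, hQ, Matrix.one_mul]
  filter_upwards [ae_all_iff.2 hY] with ω hω
  have hN' : (N : ℝ) ≠ 0 := by positivity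
  simp only [gramEstimator, hω, Finset.sum_const, Finset.card_univ, Fintype.card_fin]
  rw [← Nat.cast_smul_eq_nsmul ℝ, smul_smul, one_div, inv_mul_cancel₀ hN']
  simp

end Procrustes

theorem mainTheorem2 {d k N : ℕ} (hN : 0 < N)
    (X : Matrix (Fin d) (Fin k) ℝ) (σ : ℝ) (hσ : 0 ≤ σ)
    (ν : Measure (Matrix.orthogonalGroup (Fin d) ℝ)) [IsProbabilityMeasure ν]
    {Ω : Type*} [MeasurableSpace Ω] (P : Measure Ω) [IsProbabilityMeasure P]
    (Y : Fin N → Ω → Matrix (Fin d) (Fin k) ℝ)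
    (hindep : iIndepFun Y P)
    (hlaw : ∀ i, HasLaw (Y i) (Procrustes.observationLaw ν X σ) P) :
    -- spectral truncations of the Gram estimator exist and are projections
    (∀ ω, (Procrustes.spectralTruncations d
            (Procrustes.gramEstimator σ (fun i => Y i ω))).Nonempty ∧
        Procrustes.spectralTruncations d (Procrustes.gramEstimator σ (fun i => Y i ω)) ⊆
          Procrustes.psdRankArgmin d (Procrustes.gramEstimator σ (fun i => Y i ω))) ∧
    -- with probability at least `1 - δ`, every projection satisfies the error bound
    ∀ δ : ℝ, 0 < δ → δ < 1 →
      ∃ A : Set Ω, MeasurableSet A ∧ 1 - δ ≤ P.real A ∧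
        ∀ ω ∈ A, ∀ Gt ∈ Procrustes.psdRankArgmin d
            (Procrustes.gramEstimator σ (fun i => Y i ω)),
          Procrustes.frobNorm (Gt - X.transpose * X) ≤
            8 * Real.sqrt (2 * (d : ℝ)) *
              (Real.sqrt ((2 * Procrustes.opNorm X ^ 2 * σ ^ 2 + (d : ℝ) * σ ^ 4) / (N : ℝ)
                  * ((k : ℝ) * Real.log (10 / δ)))
                + σ ^ 2 / (N : ℝ) * ((k : ℝ) * Real.log (10 / δ))) := by
  refine ⟨fun ω => ⟨Procrustes.spectralTruncations_nonempty d
    (Procrustes.gramEstimator_isHermitian σ _),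
    Procrustes.spectralTruncations_subset_psdRankArgmin d _⟩, fun δ hδ0 hδ1 => ?_⟩
  set b := Real.sqrt ((2 * Procrustes.opNorm X ^ 2 * σ ^ 2 + (d : ℝ) * σ ^ 4) / (N : ℝ)
    * ((k : ℝ) * Real.log (10 / δ))) + σ ^ 2 / (N : ℝ) * ((k : ℝ) * Real.log (10 / δ)) with hb
  have hG : (X.transpose * X).PosSemidef := Matrix.posSemidef_conjTranspose_mul_self X
  have hGd : (X.transpose * X).rank ≤ d := by
    rw [Matrix.rank_transpose_mul_self]
    exact X.rank_le_height
  have hfrob : ∀ ω, ∀ Gt ∈ Procrustes.psdRankArgmin d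
      (Procrustes.gramEstimator σ (fun i => Y i ω)),
      Procrustes.frobNorm (Gt - X.transpose * X) ≤ Real.sqrt (2 * (d : ℝ)) *
        (2 * Procrustes.opNorm (Procrustes.gramEstimator σ (fun i => Y i ω) - X.transpose * X)) :=
    fun ω Gt hGt => Procrustes.frobNorm_sub_le_of_mem_psdRankArgmin hGt hG hGd
  rcases Nat.eq_zero_or_pos d with rfl | hd
  -- the only positive semidefinite matrix of rank `0` is `0`, so the error vanishes
  · refine ⟨Set.univ, MeasurableSet.univ, by simp [hδ0.le], fun ω _ Gt hGt => ?_⟩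
    simpa using hfrob ω Gt hGt
  let B : Set Ω := {ω | 4 * b <
    Procrustes.opNorm (Procrustes.gramEstimator σ (fun i => Y i ω) - X.transpose * X)}
  have hB : P.real B ≤ δ := by
    rcases hσ.eq_or_lt with rfl | hσ
    · have hb0 : b = 0 := by simp [hb]
      have : P B = 0 := by
        refine measure_mono_null (fun ω hω => ?_)
          (ae_iff.1 (Procrustes.gramEstimator_ae_eq_of_zero_noise hN X ν P Y hlaw))
        intro hω'
        have hω'' : 4 * b < Procrustes.opNorm _ := hω
        rw [hω', sub_self, hb0, Procrustes.opNorm_eq_norm_toEuclideanCLM, map_zero,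
          norm_zero] at hω''
        simp at hω''
      rw [measureReal_def, this]
      exact hδ0.le
    · exact Procrustes.measure_opNorm_gramEstimator_sub_gt_le hN hd X hσ ν P Y hindep hlaw hδ0 hδ1
  -- the observations are only a.e. measurable, so `B` is replaced by a measurable superset
  refine ⟨(toMeasurable P B)ᶜ, (measurableSet_toMeasurable P B).compl, ?_, ?_⟩
  · rw [probReal_compl_eq_one_sub (measurableSet_toMeasurable P B), measureReal_def,
      measure_toMeasurable, ← measureReal_def]
    linarith
  · intro ω hω Gt hGt
    have hle : Procrustes.opNorm
        (Procrustes.gramEstimator σ (fun i => Y i ω) - X.transpose * X) ≤ 4 * b :=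
      not_lt.1 fun h => hω (subset_toMeasurable P B h)
    have := mul_le_mul_of_nonneg_left hle (Real.sqrt_nonneg (2 * (d : ℝ)))
    linarith [hfrob ω Gt hGt]
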